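/- Let $X$ be a complex Banach space, let $E,A$ be bounded linear operators on $X$, and put $\rho(E,A)=\{s\in\mathbb C : sE-A \text{ is bijective}\}$ and $\sigma(E,A)=\mathbb C\setminus\rho(E,A)$. A spectral set of $(E,A)$ (of a bounded operator $T$) is a subset of $\sigma(E,A)$ (of $\sigma(T)$) which is both open and closed in it. Let $\sigma$ be a bounded spectral set of $(E,A)$. We call $(U,C)$ admissible for $\sigma$ if $U$ is a bounded open neighborhood of $\sigma$ with $\overline U\cap\sigma(E,A)=\sigma$, whose boundary $C$ consists of finitely many rectifiable Jordan curves, oriented in the positive sense (that is, $C$ has winding number $1$ about each point of $U$ and $0$ about each point outside $\overline U$). The interior (exterior) of such a $C$ consists of the points off $C$ with winding number $1$ (respectively $0$). Admissibility for a spectral set of a bounded operator $T$ is defined in the same way, with $\sigma(T)$ in place of $\sigma(E,A)$. Then the operator $$P_\sigma=\frac1{2\pi i}\int_C (zE-A)^{-1}E\,dz$$ is the same for all $(U,C)$ that are admissible for $\sigma$, and it is a projection, $P_\sigma^2=P_\sigma$. Moreover, let $\mu\in\rho(E,A)$, $T_\mu=(\mu E-A)^{-1}E$ and $\tau_\mu(z)=1/(\mu-z)$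 for $z\ne\mu$, and let $(U,C)$ be admissible for $\sigma$ with $\mu$ in the exterior of $C$. Then zero is in the exterior of $\tau_\mu(C)$; $\tau_\mu(C)$ is positively oriented, as the boundary of $\tau_\mu(U)$; $\tau_\mu(\sigma)$ is a spectral set for $T_\mu$ and is contained in the interior of $\tau_\mu(C)$; the pair $(\tau_\mu(U),\tau_\mu(C))$ is admissible for the spectral set $\tau_\mu(\sigma)$ of $T_\mu$; and $$P_\sigma=-\frac1{2\pi i}\int_{\tau_\mu(C)}(T_\mu-\lambda)^{-1}\,d\lambda,$$ i.e., $P_\sigma$ is the Riesz spectral projection of $T_\mu$ corresponding to $\tau_\mu(\sigma)$; the same formula holds with $\tau_\mu(C)$ replaced by $D$ for every pair $(V,D)$ that is admissible for the spectral set $\tau_\mu(\sigma)$ of $T_\mu$. -/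

import Mathlib

namespace OperatorPencil

section Contours

/-- A (closed) rectifiable Jordan curve in the plane with its direction of traversal, given by a
parametrization on `[0, 1]`.  Every rectifiable curve has a Lipschitz parametrization (the one of
constant speed, for instance), and the line integral does not depend on the parametrization, so
Lipschitz parametrizations are used.  The values of `γ` outside `[0, 1]` play no role. -/
structure IsRectifiableJordanCurve (γ : ℝ → ℂ) : Prop where
  lipschitz : ∃ K : NNReal, LipschitzOnWith K γ (Set.Icc 0 1)
  closed : γ 0 = γ 1
  simple : Set.InjOn γ (Set.Ico 0 1)

variable {n : ℕ}

/-- The point set of a finite family of curves. -/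
def trace (C : Fin n → ℝ → ℂ) : Set ℂ := ⋃ i, C i '' Set.Icc 0 1

/-- The line integral `∫_C f(z) dz` along a finite family of curves. -/
noncomputable def contourIntegral {F : Type*} [NormedAddCommGroup F] [NormedSpace ℂ F]
    (C : Fin n → ℝ → ℂ) (f : ℂ → F) : F :=
  ∑ i, ∫ t in (0 : ℝ)..1, deriv (C i) t • f (C i t)

/-- The winding number of `C` about `w`, for `w` off `C`. -/
noncomputable def index (C : Fin n → ℝ → ℂ) (w : ℂ) : ℂ :=
  (2 * Real.pi * Complex.I)⁻¹ * contourIntegral C (fun z => (z - w)⁻¹)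

/-- The interior of a positively oriented family of curves. -/
def interiorOf (C : Fin n → ℝ → ℂ) : Set ℂ := {w | w ∉ trace C ∧ index C w = 1}

/-- The exterior of a positively oriented family of curves. -/
def exteriorOf (C : Fin n → ℝ → ℂ) : Set ℂ := {w | w ∉ trace C ∧ index C w = 0}

/-- The boundary of `U` is `C`, which consists of finitely many rectifiable Jordan curves, oriented
in the positive sense: `C` winds once around the points of `U` and does not wind around
the points outside the closure of `U`. -/
structure IsPositivelyOrientedBoundary (U : Set ℂ) (C : Fin n → ℝ → ℂ) : Prop where
  jordan : ∀ i, IsRectifiableJordanCurve (C i)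
  frontier_eq : frontier U = trace C
  index_inside : ∀ w ∈ U, index C w = 1
  index_outside : ∀ w ∉ closure U, index C w = 0

/-- `σ` is a subset of `S` that is both open and closed in `S`. -/
def IsSpectralSet (S σ : Set ℂ) : Prop :=
  σ ⊆ S ∧ IsClopen ((↑) ⁻¹' σ : Set S)

/-- `U` is a bounded open neighborhood of `σ` with positively oriented boundary `C`, and its
closure meets the spectrum `S` exactly in `σ`. -/
structure Encloses (S σ U : Set ℂ) (C : Fin n → ℝ → ℂ) : Prop where
  isOpen : IsOpen U
  isBounded : Bornology.IsBounded U
  subset : σ ⊆ U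
  closure_inter : closure U ∩ S = σ
  boundary : IsPositivelyOrientedBoundary U C

end Contours

section Pencils

variable {X : Type*} [NormedAddCommGroup X] [NormedSpace ℂ X]

/-- `ρ(E, A)`, the set of all `s` for which `s E - A` is bijective. -/
def resolventSet (E A : X →L[ℂ] X) : Set ℂ := {s | Function.Bijective (s • E - A)}

/-- `σ(E, A)`, the complement of `ρ(E, A)` in the (finite) complex plane. -/
def pencilSpectrum (E A : X →L[ℂ] X) : Set ℂ := (resolventSet E A)ᶜ

/-- `T_z = (z E - A)⁻¹ E`; the inverse exists for `z ∈ ρ(E, A)`. -/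
noncomputable def T (E A : X →L[ℂ] X) (z : ℂ) : X →L[ℂ] X := Ring.inverse (z • E - A) * E

/-- `τ_μ(z) = 1 / (μ - z)`, used for `z ≠ μ`. -/
noncomputable def tau (μ z : ℂ) : ℂ := 1 / (μ - z)

/-- `(1 / 2πi) ∫_C (z E - A)⁻¹ E dz`. -/
noncomputable def pencilProjection {n : ℕ} (E A : X →L[ℂ] X) (C : Fin n → ℝ → ℂ) : X →L[ℂ] X :=
  (2 * Real.pi * Complex.I)⁻¹ • contourIntegral C (fun z => Ring.inverse (z • E - A) * E)

/-- The Riesz-Dunford integral `-(1 / 2πi) ∫_C (S - l)⁻¹ dl` of a bounded operator `S`. -/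
noncomputable def rieszProjection {n : ℕ} (S : X →L[ℂ] X) (C : Fin n → ℝ → ℂ) : X →L[ℂ] X :=
  -((2 * Real.pi * Complex.I)⁻¹ •
    contourIntegral C (fun l => Ring.inverse (S - l • (1 : X →L[ℂ] X))))

end Pencils

end OperatorPencil

namespace OperatorPencil

open Set Filter Topology MeasureTheory

/-! ### Line integrals over rectifiable curves and the Cauchy transform. -/

section ContourCalculus

variable {F : Type*} [NormedAddCommGroup F] [NormedSpace ℂ F]

/-! Cauchy's theorem for general contours is replaced by Liouville's theorem. Write `T(z) = (zE -
A)⁻¹E`, `P` for its normalized integral over `C`, and `F(w)` for its Cauchy transform. Integrating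
the resolvent identity `T(z) - T(w) = (w - z) T(z) T(w)` against the Cauchy kernel gives `P T(w) =
index(w) T(w) - F(w)` (`pencilProjection_mul_T`). The left side is holomorphic on the resolvent set,
and `F` is holomorphic off `C`, vanishes at infinity and satisfies `w F(w) → -P`.

For two admissible contours the index terms cancel wherever the indices agree, so `(P - P') T` and
`F' - F` glue to an entire function vanishing at infinity (`eqOn_zero_of_glue`). Hence `F = F'` near
infinity, and the leading coefficients give `P = P'`. Idempotence comes the same way from `(P - P²)
T = (P - 1) F + index · F`, which uses `index² = index`.

For the Möbius part, `T_one_T_tau` computes the resolvent of `T_μ` at `τ_μ(z)`. After the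
substitution `λ = τ_μ(z)` the integrand is `T(z)` plus a multiple of `(z - μ)⁻¹`, whose integral
vanishes since `μ` is exterior. Arbitrary contours around `τ_μ(σ)` are covered by the independence
result for the pair `(1, T_μ)`. -/

theorem IsRectifiableJordanCurve.continuousOn {γ : ℝ → ℂ} (h : IsRectifiableJordanCurve γ) :
    ContinuousOn γ (Icc 0 1) :=
  h.lipschitz.choose_spec.continuousOn

theorem IsRectifiableJordanCurve.intervalIntegrable_deriv {γ : ℝ → ℂ}
    (h : IsRectifiableJordanCurve γ) : IntervalIntegrable (deriv γ) volume 0 1 := by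
  obtain ⟨K, hK⟩ := h.lipschitz
  -- At the endpoints `deriv γ` depends on values of `γ` outside `[0, 1]`, so the Lipschitz bound is
  -- used on the open interval only.
  rw [intervalIntegrable_iff_integrableOn_Ioo_of_le zero_le_one]
  refine Measure.integrableOn_of_bounded (M := K) (by simp)
    (measurable_deriv γ).aestronglyMeasurable ?_
  filter_upwards [ae_restrict_mem measurableSet_Ioo] with t ht
  exact norm_deriv_le_of_lipschitzOn (Icc_mem_nhds ht.1 ht.2) hK

theorem IsRectifiableJordanCurve.intervalIntegrable_smul {γ : ℝ → ℂ}
    (h : IsRectifiableJordanCurve γ) {g : ℝ → F} (hg : ContinuousOn g (Icc 0 1)) :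
    IntervalIntegrable (fun t => deriv γ t • g t) volume 0 1 :=
  h.intervalIntegrable_deriv.smul_continuousOn (by rwa [uIcc_of_le zero_le_one])

variable {n : ℕ} {C : Fin n → ℝ → ℂ}

theorem mem_trace {i : Fin n} {t : ℝ} (ht : t ∈ Icc (0 : ℝ) 1) : C i t ∈ trace C :=
  mem_iUnion.2 ⟨i, t, ht, rfl⟩

theorem isCompact_trace (hC : ∀ i, IsRectifiableJordanCurve (C i)) : IsCompact (trace C) :=
  isCompact_iUnion fun i => isCompact_Icc.image_of_continuousOn (hC i).continuousOn

theorem continuousOn_comp_of_trace {Y : Type*} [TopologicalSpace Y]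
    (hC : ∀ i, IsRectifiableJordanCurve (C i)) {f : ℂ → Y} (hf : ContinuousOn f (trace C)) (i : Fin n) :
    ContinuousOn (fun t => f (C i t)) (Icc 0 1) :=
  hf.comp (hC i).continuousOn fun _ ht => mem_trace ht

theorem intervalIntegrable_of_continuousOn_trace (hC : ∀ i, IsRectifiableJordanCurve (C i))
    {f : ℂ → F} (hf : ContinuousOn f (trace C)) (i : Fin n) :
    IntervalIntegrable (fun t => deriv (C i) t • f (C i t)) volume 0 1 :=
  (hC i).intervalIntegrable_smul (continuousOn_comp_of_trace hC hf i)

theorem contourIntegral_congr {f g : ℂ → F} (h : EqOn f g (trace C)) :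
    contourIntegral C f = contourIntegral C g := by
  refine Finset.sum_congr rfl fun i _ => intervalIntegral.integral_congr fun t ht => ?_
  rw [uIcc_of_le zero_le_one] at ht
  simp only [h (mem_trace ht)]

theorem contourIntegral_sub (hC : ∀ i, IsRectifiableJordanCurve (C i)) {f g : ℂ → F}
    (hf : ContinuousOn f (trace C)) (hg : ContinuousOn g (trace C)) :
    contourIntegral C (fun z => f z - g z) = contourIntegral C f - contourIntegral C g := by
  simp only [contourIntegral, smul_sub, ← Finset.sum_sub_distrib]
  exact Finset.sum_congr rfl fun i _ => intervalIntegral.integral_sub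
    (intervalIntegrable_of_continuousOn_trace hC hf i)
    (intervalIntegrable_of_continuousOn_trace hC hg i)

theorem contourIntegral_smul (c : ℂ) (f : ℂ → F) :
    contourIntegral C (fun z => c • f z) = c • contourIntegral C f := by
  simp only [contourIntegral, Finset.smul_sum, smul_comm _ c, intervalIntegral.integral_smul]

theorem contourIntegral_neg (f : ℂ → F) :
    contourIntegral C (fun z => -f z) = -contourIntegral C f := by
  simpa using contourIntegral_smul (C := C) (-1) f

theorem contourIntegral_clm_comp [CompleteSpace F] {G : Type*} [NormedAddCommGroup G]
    [NormedSpace ℂ G] [CompleteSpace G] (hC : ∀ i, IsRectifiableJordanCurve (C i)) {f : ℂ → F}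
    (hf : ContinuousOn f (trace C)) (L : F →L[ℂ] G) :
    contourIntegral C (fun z => L (f z)) = L (contourIntegral C f) := by
  simp only [contourIntegral, map_sum, ← map_smul]
  exact Finset.sum_congr rfl fun i _ => L.intervalIntegral_comp_comm
    (intervalIntegrable_of_continuousOn_trace hC hf i)

/-- The Cauchy transform `(1 / 2πi) ∫_C (z - w)⁻¹ f(z) dz`. -/
noncomputable def cauchyTransform (C : Fin n → ℝ → ℂ) (f : ℂ → F) (w : ℂ) : F :=
  (2 * Real.pi * Complex.I)⁻¹ • contourIntegral C (fun z => (z - w)⁻¹ • f z)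

theorem continuousOn_inv_sub {s : Set ℂ} {w : ℂ} (hw : w ∉ s) :
    ContinuousOn (fun z => (z - w)⁻¹) s := by
  refine ContinuousOn.inv₀ (by fun_prop) fun z hz h => hw ?_
  rwa [← sub_eq_zero.1 h]

theorem index_eq_cauchyTransform (w : ℂ) : index C w = cauchyTransform C (fun _ => (1 : ℂ)) w := by
  simp [index, cauchyTransform]

theorem differentiableAt_cauchyTransform
    (hC : ∀ i, IsRectifiableJordanCurve (C i)) {f : ℂ → F} (hf : ContinuousOn f (trace C)) {w : ℂ}
    (hw : w ∉ trace C) : DifferentiableAt ℂ (cauchyTransform C f) w := by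
  refine DifferentiableAt.const_smul ?_ _
  unfold contourIntegral
  refine DifferentiableAt.fun_sum fun i _ => ?_
  obtain ⟨δ, hδ, hball⟩ := Metric.isOpen_iff.1 (isCompact_trace hC).isClosed.isOpen_compl w hw
  obtain ⟨M, hM⟩ := (isCompact_trace hC).exists_bound_of_continuousOn hf
  -- Halving the radius keeps the kernel bounded by `(δ / 2)⁻¹` uniformly in `x`, which supplies the
  -- dominating function for differentiation under the integral.
  have hdist : ∀ x ∈ Metric.ball w (δ / 2), ∀ z ∈ trace C, δ / 2 ≤ ‖z - x‖ := by
    intro x hx z hz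
    by_contra! h
    refine hball (a := z) ?_ hz
    rw [Metric.mem_ball] at hx ⊢
    rw [← dist_eq_norm] at h
    linarith [dist_triangle z x w]
  have hint : ∀ x ∉ trace C, IntervalIntegrable
      (fun t => deriv (C i) t • (C i t - x)⁻¹ • f (C i t)) volume 0 1 := fun x hx =>
    intervalIntegrable_of_continuousOn_trace hC ((continuousOn_inv_sub hx).smul hf) i
  refine (intervalIntegral.hasDerivAt_integral_of_dominated_loc_of_deriv_le
    (F' := fun x t => deriv (C i) t • ((C i t - x)⁻¹ ^ 2) • f (C i t))
    (bound := fun t => ‖deriv (C i) t‖ * ((δ / 2)⁻¹ ^ 2 * M))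
    (Metric.ball_mem_nhds w (half_pos hδ)) ?_ (hint w hw) ?_ ?_ ?_ ?_).2.differentiableAt
  · filter_upwards [Metric.ball_mem_nhds w hδ] with x hx
    simpa using (intervalIntegrable_iff.1 (hint x (hball hx))).aestronglyMeasurable
  · exact (intervalIntegrable_iff.1 (intervalIntegrable_of_continuousOn_trace hC
      (((continuousOn_inv_sub hw).pow 2).smul hf) i)).aestronglyMeasurable
  · refine ae_of_all _ fun t ht x hx => ?_
    rw [uIoc_of_le zero_le_one] at ht
    have hz := mem_trace (C := C) (i := i) (Ioc_subset_Icc_self ht)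
    rw [norm_smul, norm_smul, norm_pow, norm_inv]
    have := hdist x hx _ hz
    have := hM _ hz
    gcongr
  · exact (hC i).intervalIntegrable_deriv.norm.mul_const _
  · refine ae_of_all _ fun t ht x hx => ?_
    rw [uIoc_of_le zero_le_one] at ht
    have hz := mem_trace (C := C) (i := i) (Ioc_subset_Icc_self ht)
    have hne : C i t - x ≠ 0 := norm_pos_iff.1 ((half_pos hδ).trans_le (hdist x hx _ hz))
    have := ((hasDerivAt_id x).const_sub (C i t)).inv hne
    have := (this.smul_const (f (C i t))).const_smul (deriv (C i) t)
    convert this using 3 <;> simp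

theorem tendsto_cauchyTransform_cocompact
    (hC : ∀ i, IsRectifiableJordanCurve (C i)) {f : ℂ → F} (hf : ContinuousOn f (trace C)) :
    Tendsto (cauchyTransform C f) (cocompact ℂ) (𝓝 0) := by
  rw [← smul_zero (2 * Real.pi * Complex.I : ℂ)⁻¹]
  refine Tendsto.const_smul ?_ _
  rw [← Finset.sum_const_zero (s := (Finset.univ : Finset (Fin n)))]
  refine tendsto_finsetSum _ fun i _ => ?_
  obtain ⟨M, hM⟩ := (isCompact_trace hC).exists_bound_of_continuousOn hf
  obtain ⟨R, hR⟩ := (isCompact_trace hC).isBounded.exists_norm_le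
  have hlim : Tendsto (fun w : ℂ => (∫ t in (0 : ℝ)..1, ‖deriv (C i) t‖) * ((‖w‖ - R)⁻¹ * M))
      (cocompact ℂ) (𝓝 0) := by
    have := (tendsto_inv_atTop_zero.comp
      (tendsto_atTop_add_const_right _ (-R) (tendsto_norm_cocompact_atTop (E := ℂ)))).mul_const M
    simpa [Function.comp_def, ← sub_eq_add_neg] using
      this.const_mul (∫ t in (0 : ℝ)..1, ‖deriv (C i) t‖)
  refine squeeze_zero_norm' ?_ hlim
  filter_upwards [(tendsto_norm_cocompact_atTop (E := ℂ)).eventually_gt_atTop R] with w hw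
  rw [← intervalIntegral.integral_mul_const]
  refine intervalIntegral.norm_integral_le_of_norm_le zero_le_one (ae_of_all _ fun t ht => ?_)
    ((hC i).intervalIntegrable_deriv.norm.mul_const _)
  have hz := mem_trace (C := C) (i := i) (Ioc_subset_Icc_self ht)
  have h1 : ‖w‖ - R ≤ ‖C i t - w‖ := by
    linarith [norm_sub_norm_le w (C i t), norm_sub_rev w (C i t), hR _ hz]
  have h2 := hM _ hz
  have h3 : 0 < ‖w‖ - R := sub_pos.2 hw
  rw [norm_smul, norm_smul, norm_inv]
  gcongr

/-- The Cauchy transform behaves like `-w⁻¹ (1 / 2πi) ∫_C f(z) dz` at infinity. -/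
theorem smul_cauchyTransform (hC : ∀ i, IsRectifiableJordanCurve (C i)) {f : ℂ → F}
    (hf : ContinuousOn f (trace C)) {w : ℂ} (hw : w ∉ trace C) :
    w • cauchyTransform C f w = cauchyTransform C (fun z => z • f z) w -
      (2 * Real.pi * Complex.I : ℂ)⁻¹ • contourIntegral C f := by
  rw [cauchyTransform, cauchyTransform, smul_comm, ← smul_sub, ← contourIntegral_smul,
    ← contourIntegral_sub hC (f := fun z => (z - w)⁻¹ • z • f z)
      ((continuousOn_inv_sub hw).smul (continuousOn_id.smul hf)) hf]
  congr 1
  refine contourIntegral_congr fun z hz => ?_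
  have hne : z - w ≠ 0 := fun h => hw (sub_eq_zero.1 h ▸ hz)
  have : w * (z - w)⁻¹ = (z - w)⁻¹ * z - 1 := by field_simp; ring
  simp only [smul_smul, this, sub_smul, one_smul]

end ContourCalculus

/-! ### Change of variables under `τ_μ`. -/

section MoebiusChange

variable {F : Type*} [NormedAddCommGroup F] [NormedSpace ℂ F] {n : ℕ} {C : Fin n → ℝ → ℂ}

theorem tau_involution (μ z : ℂ) : μ - 1 / tau μ z = z := by simp [tau]

/-- The convention `1 / 0 = 0` makes this true at `l = 0` as well: `tau μ` becomes a bijection of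
the plane sending `μ` to `0`. -/
theorem tau_sub_inv (μ l : ℂ) : tau μ (μ - 1 / l) = l := by simp [tau]

theorem tau_injective (μ : ℂ) : Function.Injective (tau μ) :=
  Function.LeftInverse.injective (g := fun l => μ - 1 / l) (tau_involution μ)

theorem tau_ne_zero {μ z : ℂ} (h : z ≠ μ) : tau μ z ≠ 0 := by
  simpa [tau, sub_eq_zero] using h.symm

theorem hasDerivAt_tau {μ z : ℂ} (h : z ≠ μ) :
    HasDerivAt (tau μ) ((μ - z)⁻¹ ^ 2) z := by
  have := ((hasDerivAt_id z).const_sub μ).inv (sub_ne_zero.2 h.symm)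
  have h : tau μ = fun z => (μ - z)⁻¹ := by ext; simp [tau]
  simpa [h, Pi.inv_def] using this

theorem deriv_tau_comp {μ : ℂ} {γ : ℝ → ℂ} {t : ℝ} (h : γ t ≠ μ) :
    deriv (fun s => tau μ (γ s)) t = (μ - γ t)⁻¹ ^ 2 * deriv γ t := by
  by_cases hd : DifferentiableAt ℝ γ t
  · exact ((hasDerivAt_tau h).comp_of_eq t hd.hasDerivAt rfl).deriv
  -- At a point where `γ` is not differentiable neither is `τ_μ ∘ γ`, since `γ` is recovered from it
  -- by `μ - 1 / l`; both derivatives take the default value `0`.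
  · rw [deriv_zero_of_not_differentiableAt hd, mul_zero]
    refine deriv_zero_of_not_differentiableAt fun hd' => hd ?_
    have := (hd'.inv (tau_ne_zero h)).const_sub μ
    simpa [tau] using this

theorem trace_tau (μ : ℂ) (C : Fin n → ℝ → ℂ) :
    trace (fun i t => tau μ (C i t)) = tau μ '' trace C := by
  simp only [trace, image_iUnion, image_image]

theorem contourIntegral_tau {μ : ℂ} (hμ : μ ∉ trace C) (f : ℂ → F) :
    contourIntegral (fun i t => tau μ (C i t)) f =
      contourIntegral C (fun z => (μ - z)⁻¹ ^ 2 • f (tau μ z)) := by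
  refine Finset.sum_congr rfl fun i _ => intervalIntegral.integral_congr fun t ht => ?_
  rw [uIcc_of_le zero_le_one] at ht
  have hne : C i t ≠ μ := fun h => hμ (h ▸ mem_trace ht)
  simp only [deriv_tau_comp hne, smul_smul, mul_comm]

/-- The substitution turns `dλ / (λ - τ_μ(w))` into `((z - w)⁻¹ - (z - μ)⁻¹) dz`; the second term
appears because `τ_μ` sends `μ` to infinity. -/
theorem index_tau (hC : ∀ i, IsRectifiableJordanCurve (C i)) {μ w : ℂ} (hμ : μ ∉ trace C)
    (hw : w ∉ trace C) (hne : w ≠ μ) :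
    index (fun i t => tau μ (C i t)) (tau μ w) = index C w - index C μ := by
  rw [index, index, index, contourIntegral_tau hμ, ← mul_sub,
    ← contourIntegral_sub hC (continuousOn_inv_sub hw) (continuousOn_inv_sub hμ)]
  congr 1
  refine contourIntegral_congr fun z hz => ?_
  have h1 : z - w ≠ 0 := fun h => hw (sub_eq_zero.1 h ▸ hz)
  have h2 : z - μ ≠ 0 := fun h => hμ (sub_eq_zero.1 h ▸ hz)
  have h3 : μ - w ≠ 0 := sub_ne_zero.2 hne.symm
  have h4 : μ - z ≠ 0 := fun h => h2 (by linear_combination -h)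
  have h5 : tau μ z - tau μ w = (z - w) / ((μ - z) * (μ - w)) := by
    simp only [tau]; field_simp; ring
  simp only [h5, smul_eq_mul]
  field_simp
  ring

/-- The point `0` is the image of infinity, about which `C` contributes no winding; only the term
from `μ` remains. -/
theorem index_tau_zero {μ : ℂ} (hμ : μ ∉ trace C) :
    index (fun i t => tau μ (C i t)) 0 = -index C μ := by
  rw [index, index, contourIntegral_tau hμ, ← mul_neg, ← contourIntegral_neg]
  congr 1
  refine contourIntegral_congr fun z hz => ?_
  have h2 : z - μ ≠ 0 := fun h => hμ (sub_eq_zero.1 h ▸ hz)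
  have h4 : μ - z ≠ 0 := fun h => h2 (by linear_combination -h)
  simp only [tau, smul_eq_mul]
  field_simp
  ring

theorem IsRectifiableJordanCurve.tau {μ : ℂ} {γ : ℝ → ℂ} (h : IsRectifiableJordanCurve γ)
    (hμ : μ ∉ γ '' Icc 0 1) : IsRectifiableJordanCurve (fun t => tau μ (γ t)) where
  lipschitz := by
    obtain ⟨K, hK⟩ := h.lipschitz
    have hc : IsCompact (γ '' Icc 0 1) := isCompact_Icc.image_of_continuousOn h.continuousOn
    obtain ⟨M, hM⟩ := hc.exists_bound_of_continuousOn (continuousOn_inv_sub hμ)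
    have hM0 : 0 ≤ M := (norm_nonneg _).trans (hM (γ 0) ⟨0, by simp, rfl⟩)
    lift M to NNReal using hM0
    refine ⟨M * M * K, LipschitzOnWith.of_dist_le_mul fun s hs t ht => ?_⟩
    have hs' : γ s ∈ γ '' Icc 0 1 := mem_image_of_mem γ hs
    have ht' : γ t ∈ γ '' Icc 0 1 := mem_image_of_mem γ ht
    have h1 : γ s - μ ≠ 0 := fun h => hμ (sub_eq_zero.1 h ▸ hs')
    have h2 : γ t - μ ≠ 0 := fun h => hμ (sub_eq_zero.1 h ▸ ht')
    have h3 : μ - γ s ≠ 0 := fun h => h1 (by linear_combination -h)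
    have h4 : μ - γ t ≠ 0 := fun h => h2 (by linear_combination -h)
    have h5 : OperatorPencil.tau μ (γ s) - OperatorPencil.tau μ (γ t) =
        (γ s - μ)⁻¹ * (γ t - μ)⁻¹ * (γ s - γ t) := by
      simp only [OperatorPencil.tau]; field_simp; ring
    rw [dist_eq_norm, h5, norm_mul, norm_mul, ← dist_eq_norm]
    have := hK.dist_le_mul s hs t ht
    have := hM _ hs'
    have := hM _ ht'
    calc _ ≤ M * M * (K * dist s t) := by gcongr
      _ = _ := by push_cast; ring
  closed := by simp only [h.closed]
  simple := fun _ hs _ ht hst => h.simple hs ht (tau_injective μ hst)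

end MoebiusChange

/-! ### Gluing and Liouville's theorem. -/

section Liouville

variable {F : Type*} [NormedAddCommGroup F] [NormedSpace ℂ F]

/-- Two holomorphic functions that agree on the intersection of their domains, which cover the
plane, glue to an entire function; if it vanishes at infinity, it is zero. -/
theorem eqOn_zero_of_glue {ρ V : Set ℂ} (hρ : IsOpen ρ) (hV : IsOpen V) (hcov : ρ ∪ V = univ)
    {h G : ℂ → F} (hh : DifferentiableOn ℂ h ρ) (hG : DifferentiableOn ℂ G V)
    (heq : EqOn h G (ρ ∩ V)) (hVb : Bornology.IsBounded Vᶜ)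
    (hlim : Tendsto G (cocompact ℂ) (𝓝 0)) : EqOn G 0 V := by
  classical
  have hHG : EqOn (V.piecewise G h) G V := piecewise_eqOn V G h
  have hHh : EqOn (V.piecewise G h) h ρ := fun z hz => by
    by_cases hzV : z ∈ V
    · rw [hHG hzV, heq ⟨hz, hzV⟩]
    · exact piecewise_eq_of_notMem V G h hzV
  have hdiff : Differentiable ℂ (V.piecewise G h) := fun z => by
    rcases (hcov ▸ mem_univ z : z ∈ ρ ∪ V) with hz | hz
    · exact ((hh.congr hHh) z hz).differentiableAt (hρ.mem_nhds hz)
    · exact ((hG.congr hHG) z hz).differentiableAt (hV.mem_nhds hz)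
  have hlim' : Tendsto (V.piecewise G h) (cocompact ℂ) (𝓝 0) := by
    refine hlim.congr' ?_
    rw [← Metric.cobounded_eq_cocompact]
    filter_upwards [Bornology.isBounded_def.1 hVb] with z hz
    exact (hHG (by simpa using hz)).symm
  exact fun z hz => by rw [← hHG hz, hdiff.apply_eq_of_tendsto_cocompact z hlim']; rfl

end Liouville

/-! ### Resolvent identity of the pencil. -/

section Resolvent

variable {X : Type*} [NormedAddCommGroup X] [NormedSpace ℂ X] {E A : X →L[ℂ] X}

theorem pencilProjection_eq {n : ℕ} {C : Fin n → ℝ → ℂ} :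
    pencilProjection E A C = (2 * Real.pi * Complex.I : ℂ)⁻¹ • contourIntegral C (T E A) := rfl

variable [CompleteSpace X]

theorem mem_resolventSet_iff {z : ℂ} : z ∈ resolventSet E A ↔ IsUnit (z • E - A) :=
  ContinuousLinearMap.isUnit_iff_bijective.symm

theorem isOpen_resolventSet (E A : X →L[ℂ] X) : IsOpen (resolventSet E A) := by
  have : resolventSet E A = (fun z : ℂ => z • E - A) ⁻¹' {x | IsUnit x} := by
    ext; exact mem_resolventSet_iff
  rw [this]
  exact Units.isOpen.preimage (by fun_prop)

theorem differentiableOn_T (E A : X →L[ℂ] X) :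
    DifferentiableOn ℂ (T E A) (resolventSet E A) := fun z hz => by
  have h1 : DifferentiableAt ℂ (fun z : ℂ => z • E - A) z := by fun_prop
  have h2 := (differentiableAt_inverse (𝕜 := ℂ) (mem_resolventSet_iff.1 hz)).comp z h1
  exact (h2.mul_const E).differentiableWithinAt

theorem T_sub_T {z w : ℂ} (hz : z ∈ resolventSet E A) (hw : w ∈ resolventSet E A) :
    T E A z - T E A w = (w - z) • (T E A z * T E A w) := by
  have h1 := Ring.inverse_mul_cancel _ (mem_resolventSet_iff.1 hz)
  have h2 := Ring.mul_inverse_cancel _ (mem_resolventSet_iff.1 hw)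
  unfold T
  set R := Ring.inverse (z • E - A)
  set S := Ring.inverse (w • E - A)
  calc R * E - S * E = R * ((w • E - A) * S) * E - (R * (z • E - A)) * S * E := by
        rw [h1, h2]; simp
    _ = R * ((w - z) • E) * (S * E) := by
        rw [sub_smul]; noncomm_ring
    _ = _ := by simp [mul_assoc]

variable {n : ℕ} {C : Fin n → ℝ → ℂ}

/-- The fundamental identity behind the calculus of the projections. -/
theorem pencilProjection_mul_T (hC : ∀ i, IsRectifiableJordanCurve (C i))
    (hCρ : trace C ⊆ resolventSet E A) {w : ℂ} (hw : w ∈ resolventSet E A) (hwC : w ∉ trace C) :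
    pencilProjection E A C * T E A w = index C w • T E A w - cauchyTransform C (T E A) w := by
  have hT : ContinuousOn (T E A) (trace C) := (differentiableOn_T E A).continuousOn.mono hCρ
  have hi := continuousOn_inv_sub hwC
  have h1 := contourIntegral_clm_comp hC hT ((ContinuousLinearMap.mul ℂ (X →L[ℂ] X)).flip (T E A w))
  have h2 := contourIntegral_clm_comp hC hi
    (ContinuousLinearMap.toSpanSingleton ℂ (T E A w))
  simp only [ContinuousLinearMap.flip_apply, ContinuousLinearMap.mul_apply',
    ContinuousLinearMap.toSpanSingleton_apply] at h1 h2
  rw [pencilProjection_eq, smul_mul_assoc, ← h1, index, mul_smul, ← h2, cauchyTransform, ← smul_sub,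
    ← contourIntegral_sub hC (f := fun z => (z - w)⁻¹ • T E A w) (g := fun z => (z - w)⁻¹ • T E A z)
      (hi.smul continuousOn_const) (hi.smul hT)]
  congr 1
  refine contourIntegral_congr fun z hz => ?_
  have hne : z - w ≠ 0 := fun h => hwC (sub_eq_zero.1 h ▸ hz)
  -- The factor `z - w` from the resolvent identity cancels the Cauchy kernel and leaves the
  -- integrand of `P T(w)`.
  have h3 : T E A w - T E A z = (z - w) • (T E A z * T E A w) := by
    rw [← neg_sub, T_sub_T (hCρ hz) hw, ← neg_smul, neg_sub]
  simp only [← smul_sub, h3, smul_smul, inv_mul_cancel₀ hne, one_smul]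

end Resolvent

/-! ### Position of points relative to an admissible pair. -/

section Enclosure

variable {n m : ℕ} {S σ U U' : Set ℂ} {C : Fin n → ℝ → ℂ} {C' : Fin m → ℝ → ℂ}

theorem Encloses.notMem_trace (h : Encloses S σ U C) {w : ℂ} (hw : w ∈ U) : w ∉ trace C := by
  rw [← h.boundary.frontier_eq, h.isOpen.frontier_eq]
  exact fun h => h.2 hw

theorem Encloses.trace_subset_closure (h : Encloses S σ U C) : trace C ⊆ closure U :=
  h.boundary.frontier_eq ▸ frontier_subset_closure

theorem Encloses.trace_subset_compl (h : Encloses S σ U C) : trace C ⊆ Sᶜ := fun _ hz hS =>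
  h.notMem_trace (h.subset (h.closure_inter ▸ ⟨h.trace_subset_closure hz, hS⟩)) hz

theorem Encloses.mem_or_notMem_closure (h : Encloses S σ U C) {w : ℂ} (hw : w ∉ trace C) :
    w ∈ U ∨ w ∉ closure U := by
  by_contra! hcon
  rw [← h.boundary.frontier_eq, h.isOpen.frontier_eq] at hw
  exact hw ⟨hcon.2, hcon.1⟩

theorem Encloses.notMem_closure_of_mem_exteriorOf (h : Encloses S σ U C) {w : ℂ}
    (hw : w ∈ exteriorOf C) : w ∉ closure U :=
  (h.mem_or_notMem_closure hw.1).resolve_left fun hU =>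
    one_ne_zero ((h.boundary.index_inside w hU).symm.trans hw.2)

end Enclosure

/-! ### Independence of the contour, and idempotence. -/

section Projection

variable {X : Type*} [NormedAddCommGroup X] [NormedSpace ℂ X]
  {E A : X →L[ℂ] X} {n m : ℕ} {σ U U' : Set ℂ} {C : Fin n → ℝ → ℂ} {C' : Fin m → ℝ → ℂ}

theorem Encloses.trace_subset_resolventSet (h : Encloses (pencilSpectrum E A) σ U C) :
    trace C ⊆ resolventSet E A := by
  simpa [pencilSpectrum] using h.trace_subset_compl

variable [CompleteSpace X]

theorem Encloses.continuousOn_T (h : Encloses (pencilSpectrum E A) σ U C) :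
    ContinuousOn (T E A) (trace C) :=
  (differentiableOn_T E A).continuousOn.mono h.trace_subset_resolventSet

theorem pencilProjection_eq_of_encloses (h : Encloses (pencilSpectrum E A) σ U C)
    (h' : Encloses (pencilSpectrum E A) σ U' C') :
    pencilProjection E A C = pencilProjection E A C' := by
  have hC := h.boundary.jordan
  have hC' := h'.boundary.jordan
  -- On `V` both indices are `1` or both are `0`. Spectral points in `σ` lie in `U ∩ U'` and all
  -- others lie outside both closures, so `V` and the resolvent set cover the plane.
  set V : Set ℂ := (U ∩ U') ∪ (closure U ∪ closure U')ᶜ with hVdef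
  have hV : IsOpen V := (h.isOpen.inter h'.isOpen).union
    (isClosed_closure.union isClosed_closure).isOpen_compl
  have hoff : ∀ w ∈ V, w ∉ trace C ∧ w ∉ trace C' ∧ index C w = index C' w := by
    rintro w (⟨hw, hw'⟩ | hw)
    · exact ⟨h.notMem_trace hw, h'.notMem_trace hw',
        (h.boundary.index_inside w hw).trans (h'.boundary.index_inside w hw').symm⟩
    · rw [compl_union] at hw
      exact ⟨fun ht => hw.1 (h.trace_subset_closure ht),
        fun ht => hw.2 (h'.trace_subset_closure ht),
        (h.boundary.index_outside w hw.1).trans (h'.boundary.index_outside w hw.2).symm⟩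
  have hVb : Bornology.IsBounded Vᶜ := by
    refine (h.isBounded.closure.union h'.isBounded.closure).subset ?_
    rw [hVdef, compl_union, compl_compl]
    exact inter_subset_right
  have hcov : resolventSet E A ∪ V = univ := by
    refine eq_univ_of_forall fun w => or_iff_not_imp_left.2 fun hw => ?_
    by_cases hσ : w ∈ σ
    · exact Or.inl ⟨h.subset hσ, h'.subset hσ⟩
    · refine Or.inr ?_
      rw [compl_union]
      exact ⟨fun hc => hσ (h.closure_inter ▸ ⟨hc, hw⟩), fun hc => hσ (h'.closure_inter ▸ ⟨hc, hw⟩)⟩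
  have hzero := eqOn_zero_of_glue (isOpen_resolventSet E A) hV hcov
    (h := fun w => (pencilProjection E A C - pencilProjection E A C') * T E A w)
    (G := fun w => cauchyTransform C' (T E A) w - cauchyTransform C (T E A) w)
    ((differentiableOn_T E A).const_mul _)
    (fun w hw => ((differentiableAt_cauchyTransform hC' h'.continuousOn_T (hoff w hw).2.1).sub
      (differentiableAt_cauchyTransform hC h.continuousOn_T (hoff w hw).1)).differentiableWithinAt)
    (fun w hw => by
      obtain ⟨h1, h2, h3⟩ := hoff w hw.2
      simp only [sub_mul, pencilProjection_mul_T hC h.trace_subset_resolventSet hw.1 h1,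
        pencilProjection_mul_T hC' h'.trace_subset_resolventSet hw.1 h2, h3]
      abel)
    hVb
    (by
      simpa using (tendsto_cauchyTransform_cocompact hC' h'.continuousOn_T).sub
        (tendsto_cauchyTransform_cocompact hC h.continuousOn_T))
  -- Multiplying the equal transforms by `w` shows that, near infinity, the transforms of `z T(z)`
  -- differ by the constant `P - P'`; their difference tends to `0`.
  have hlim := (tendsto_cauchyTransform_cocompact hC
    (continuousOn_id.smul h.continuousOn_T)).sub
    (tendsto_cauchyTransform_cocompact hC' (continuousOn_id.smul h'.continuousOn_T))
  rw [sub_zero] at hlim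
  refine sub_eq_zero.1 (tendsto_nhds_unique (hlim.congr' ?_) tendsto_const_nhds).symm
  rw [← Metric.cobounded_eq_cocompact]
  filter_upwards [Bornology.isBounded_def.1 hVb] with w hw
  rw [compl_compl] at hw
  obtain ⟨h1, h2, -⟩ := hoff w hw
  have h3 := smul_cauchyTransform hC h.continuousOn_T h1
  have h4 := smul_cauchyTransform hC' h'.continuousOn_T h2
  rw [← pencilProjection_eq] at h3 h4
  have h5 : cauchyTransform C' (T E A) w = cauchyTransform C (T E A) w := sub_eq_zero.1 (hzero hw)
  rw [h5, h3] at h4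
  exact sub_eq_sub_iff_sub_eq_sub.1 h4

theorem isIdempotentElem_pencilProjection (h : Encloses (pencilSpectrum E A) σ U C) :
    IsIdempotentElem (pencilProjection E A C) := by
  have hC := h.boundary.jordan
  have hcl := (isCompact_trace hC).isClosed
  set P := pencilProjection E A C with hP
  have hF := tendsto_cauchyTransform_cocompact hC h.continuousOn_T
  have hcov : resolventSet E A ∪ (trace C)ᶜ = univ :=
    eq_univ_of_forall fun w => or_iff_not_imp_right.2 fun hw =>
      h.trace_subset_resolventSet (not_not.1 hw)
  have hcob : (trace C)ᶜ ∈ cocompact ℂ := (isCompact_trace hC).compl_mem_cocompact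
  have hzero := eqOn_zero_of_glue (isOpen_resolventSet E A) hcl.isOpen_compl hcov
    (h := fun w => (P - P * P) * T E A w)
    (G := fun w => (P - 1) * cauchyTransform C (T E A) w +
      index C w • cauchyTransform C (T E A) w)
    ((differentiableOn_T E A).const_mul _)
    (fun w hw => by
      have h1 := differentiableAt_cauchyTransform hC h.continuousOn_T hw
      have h2 := differentiableAt_cauchyTransform hC (f := fun _ => (1 : ℂ)) continuousOn_const hw
      simp only [index_eq_cauchyTransform]
      exact ((h1.const_mul _).add (h2.smul h1)).differentiableWithinAt)
    (fun w hw => by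
      -- Off the trace the index is `0` or `1`; this is what makes the function `G` equal `(P - P²)
      -- T`.
      have h1 : index C w * index C w = index C w := by
        rcases h.mem_or_notMem_closure hw.2 with hU | hU
        · simp [h.boundary.index_inside w hU]
        · simp [h.boundary.index_outside w hU]
      have h2 := pencilProjection_mul_T hC h.trace_subset_resolventSet hw.1 hw.2
      have h3 : cauchyTransform C (T E A) w = index C w • T E A w - P * T E A w := by
        rw [hP, h2]; abel
      simp only [h3, sub_mul, mul_sub, mul_smul_comm, smul_sub, smul_smul, h1, one_mul, mul_assoc]
      abel)
    (by rw [compl_compl]; exact (isCompact_trace hC).isBounded)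
    (by
      have := tendsto_cauchyTransform_cocompact hC (f := fun _ => (1 : ℂ)) continuousOn_const
      simp only [index_eq_cauchyTransform]
      simpa using (hF.const_mul (P - 1)).add (this.smul hF))
  have hlim := (tendsto_cauchyTransform_cocompact hC
    (continuousOn_id.smul h.continuousOn_T)).const_mul (P - 1)
  rw [mul_zero] at hlim
  -- Outside `closure U` the index vanishes, so `(P - 1) F(w) = 0` there; multiplying by `w` and
  -- letting `w → ∞` isolates `(P - 1) P`.
  have key : (P - 1) * P = 0 := by
    refine (tendsto_nhds_unique (hlim.congr' ?_) tendsto_const_nhds).symm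
    rw [← Metric.cobounded_eq_cocompact]
    filter_upwards [Bornology.isBounded_def.1 h.isBounded.closure] with w hw
    have h1 : w ∉ trace C := fun ht => hw (h.trace_subset_closure ht)
    have h2 := hzero h1
    have h3 := smul_cauchyTransform hC h.continuousOn_T h1
    rw [← pencilProjection_eq, ← hP] at h3
    simp only [h.boundary.index_outside w hw, zero_smul, add_zero, Pi.zero_apply] at h2
    have h4 : (P - 1) * (w • cauchyTransform C (T E A) w) = 0 := by
      rw [mul_smul_comm, h2, smul_zero]
    rw [h3, mul_sub] at h4
    exact sub_eq_zero.1 h4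
  rw [sub_mul, one_mul] at key
  exact sub_eq_zero.1 key

end Projection

/-! ### Topology of images under `τ_μ`. -/

section MoebiusImage

variable {μ : ℂ} {s : Set ℂ}

theorem continuousOn_tau (hs : μ ∉ s) : ContinuousOn (tau μ) s := fun _ hz =>
  (hasDerivAt_tau (ne_of_mem_of_not_mem hz hs)).continuousAt.continuousWithinAt

/-- Expressing the image as a preimage under the inverse map reduces openness of `τ_μ(s)` to
continuity of `l ↦ μ - 1 / l` off `0`. -/
theorem image_tau_eq (hs : μ ∉ s) : tau μ '' s = {0}ᶜ ∩ (fun l => μ - 1 / l) ⁻¹' s := by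
  ext l
  constructor
  · rintro ⟨z, hz, rfl⟩
    exact ⟨tau_ne_zero (ne_of_mem_of_not_mem hz hs), by simpa only [mem_preimage, tau_involution]⟩
  · rintro ⟨-, hl⟩
    exact ⟨_, hl, tau_sub_inv μ l⟩

theorem isOpen_image_tau (hs : μ ∉ s) (ho : IsOpen s) : IsOpen (tau μ '' s) := by
  rw [image_tau_eq hs]
  refine ContinuousOn.isOpen_inter_preimage ?_ isOpen_compl_singleton ho
  exact continuousOn_const.sub (continuousOn_const.div continuousOn_id fun _ h => h)

theorem closure_image_tau (hs : μ ∉ closure s) (hb : Bornology.IsBounded s) :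
    closure (tau μ '' s) = tau μ '' closure s :=
  (image_closure_of_isCompact hb.isCompact_closure (continuousOn_tau hs)).symm

end MoebiusImage

/-! ### Admissible pairs and their images under `τ_μ`. -/

section MoebiusEnclosure

variable {n : ℕ} {S S' σ U : Set ℂ} {C : Fin n → ℝ → ℂ} {μ : ℂ}

/-- Within `S`, the set `σ` is cut out both by the open set `U` and by the closed set `closure U`.
-/
theorem Encloses.isSpectralSet (h : Encloses S σ U C) : IsSpectralSet S σ := by
  have h1 : ((↑) ⁻¹' σ : Set S) = (↑) ⁻¹' U := by
    ext z
    exact ⟨fun hz => h.subset hz, fun hz => h.closure_inter ▸ ⟨subset_closure hz, z.2⟩⟩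
  have h2 : ((↑) ⁻¹' σ : Set S) = (↑) ⁻¹' closure U := by
    ext z
    exact ⟨fun hz => subset_closure (h.subset hz), fun hz => h.closure_inter ▸ ⟨hz, z.2⟩⟩
  exact ⟨h.closure_inter ▸ inter_subset_right,
    h2 ▸ isClosed_closure.preimage continuous_subtype_val,
    h1 ▸ h.isOpen.preimage continuous_subtype_val⟩

theorem Encloses.subset_interiorOf (h : Encloses S σ U C) : σ ⊆ interiorOf C := fun z hz =>
  ⟨h.notMem_trace (h.subset hz), h.boundary.index_inside z (h.subset hz)⟩

theorem zero_mem_exteriorOf_tau (hμ : μ ∈ exteriorOf C) :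
    (0 : ℂ) ∈ exteriorOf (fun i t => tau μ (C i t)) := by
  refine ⟨?_, by rw [index_tau_zero hμ.1, hμ.2, neg_zero]⟩
  rw [trace_tau, image_tau_eq hμ.1]
  exact fun h => h.1 rfl

theorem Encloses.tau (h : Encloses S σ U C) (hμ : μ ∈ exteriorOf C)
    (hS : ∀ z ≠ μ, tau μ z ∈ S' ↔ z ∈ S) :
    Encloses S' (tau μ '' σ) (tau μ '' U) (fun i t => tau μ (C i t)) := by
  have hC := h.boundary.jordan
  have hμc := h.notMem_closure_of_mem_exteriorOf hμ
  have hμU : μ ∉ U := fun hU => hμc (subset_closure hU)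
  have hcl := closure_image_tau hμc h.isBounded
  have hop := isOpen_image_tau hμU h.isOpen
  have hne : ∀ {z}, z ∈ closure U → z ≠ μ := fun hz => ne_of_mem_of_not_mem hz hμc
  refine ⟨hop, ?_, image_mono h.subset, ?_, ?_⟩
  · exact (h.isBounded.isCompact_closure.image_of_continuousOn
      (continuousOn_tau hμc)).isBounded.subset (image_mono subset_closure)
  · rw [hcl, ← h.closure_inter]
    ext l
    constructor
    · rintro ⟨⟨z, hz, rfl⟩, hl⟩
      exact ⟨z, ⟨hz, (hS z (hne hz)).1 hl⟩, rfl⟩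
    · rintro ⟨z, hz, rfl⟩
      exact ⟨⟨z, hz.1, rfl⟩, (hS z (hne hz.1)).2 hz.2⟩
  · refine ⟨fun i => (hC i).tau fun ⟨t, ht, hti⟩ => hμ.1 (hti ▸ mem_trace ht), ?_, ?_, ?_⟩
    · rw [hop.frontier_eq, hcl, ← image_sdiff (tau_injective μ), ← h.isOpen.frontier_eq,
        h.boundary.frontier_eq, trace_tau]
    · rintro _ ⟨z, hz, rfl⟩
      rw [index_tau hC hμ.1 (h.notMem_trace hz) (hne (subset_closure hz)),
        h.boundary.index_inside z hz, hμ.2, sub_zero]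
    · intro l hl
      -- The point `l = 0` corresponds to infinity rather than to a point `z ≠ μ`, so `index_tau`
      -- does not reach it.
      rcases eq_or_ne l 0 with rfl | hl0
      · exact (zero_mem_exteriorOf_tau hμ).2
      · obtain ⟨z, rfl⟩ : ∃ z, OperatorPencil.tau μ z = l := ⟨_, tau_sub_inv μ l⟩
        have hz : z ∉ closure U := fun hz => hl (hcl ▸ mem_image_of_mem _ hz)
        have hzμ : z ≠ μ := by rintro rfl; simp [OperatorPencil.tau] at hl0
        rw [index_tau hC hμ.1 (fun ht => hz (h.trace_subset_closure ht)) hzμ,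
          h.boundary.index_outside z hz, hμ.2, sub_zero]

end MoebiusEnclosure

/-! ### The Riesz projection of `T_μ`. -/

section Riesz

theorem ringInverse_neg {R : Type*} [Ring R] (a : R) : Ring.inverse (-a) = -Ring.inverse a := by
  by_cases h : IsUnit a
  · obtain ⟨u, rfl⟩ := h
    rw [← Units.val_neg, Ring.inverse_unit, Ring.inverse_unit, inv_neg, Units.val_neg]
  · rw [Ring.inverse_non_unit _ h, Ring.inverse_non_unit _ (mt (IsUnit.neg_iff a).1 h), neg_zero]

variable {X : Type*} [NormedAddCommGroup X] [NormedSpace ℂ X] {E A B : X →L[ℂ] X}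
  {n : ℕ} {C : Fin n → ℝ → ℂ} {μ z : ℂ}

/-- This makes the independence theorem for pencils available for Riesz projections. -/
theorem rieszProjection_eq_pencilProjection :
    rieszProjection B C = pencilProjection 1 B C := by
  rw [rieszProjection, pencilProjection, ← smul_neg, ← contourIntegral_neg]
  congr 1
  refine contourIntegral_congr fun l _ => ?_
  simp only [mul_one]
  rw [← ringInverse_neg, neg_sub]

variable [CompleteSpace X]

theorem pencilSpectrum_one : pencilSpectrum 1 B = spectrum ℂ B := by
  ext l
  rw [pencilSpectrum, mem_compl_iff, mem_resolventSet_iff, spectrum.mem_iff,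
    Algebra.algebraMap_eq_smul_one]

/-- The factorization `τ_μ(z) - T_μ = τ_μ(z) (μE - A)⁻¹ (zE - A)` has invertible first two factors.
-/
theorem tau_mem_spectrum_T_iff (hμ : μ ∈ resolventSet E A) (hz : z ≠ μ) :
    tau μ z ∈ spectrum ℂ (T E A μ) ↔ z ∈ pencilSpectrum E A := by
  have hu := mem_resolventSet_iff.1 hμ
  have h1 := Ring.inverse_mul_cancel _ hu
  have hτ := tau_ne_zero hz
  have hτ' : tau μ z * (μ - z) = 1 := by
    rw [tau, one_div, inv_mul_cancel₀ (sub_ne_zero.2 hz.symm)]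
  have key : algebraMap ℂ (X →L[ℂ] X) (tau μ z) - T E A μ =
      Ring.inverse (μ • E - A) * (tau μ z • (z • E - A)) := by
    have h2 : tau μ z • (z • E - A) = tau μ z • (μ • E - A) - E := by
      have : tau μ z • (z • E - A) = tau μ z • (μ • E - A) - (tau μ z * (μ - z)) • E := by module
      rw [this, hτ', one_smul]
    rw [h2, mul_sub, mul_smul_comm, h1, T, Algebra.algebraMap_eq_smul_one]
  rw [spectrum.mem_iff, key, pencilSpectrum, mem_compl_iff, mem_resolventSet_iff,
    (isUnit_ringInverse.2 hu).mul_left_iff,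
    ← Units.smul_mk0 hτ, isUnit_smul_iff]

/-- By the same factorization the inverse should be `(μ - z)(zE - A)⁻¹(μE - A)`, and `μE - A = (zE -
A) + (μ - z)E` gives the right side. The resolvent identity, in both orders, verifies the two
one-sided inverses. -/
theorem T_one_T_tau (hμ : μ ∈ resolventSet E A) (hz : z ∈ resolventSet E A) (hne : z ≠ μ) :
    T 1 (T E A μ) (tau μ z) = (μ - z) • 1 + (μ - z) ^ 2 • T E A z := by
  have h0 : μ - z ≠ 0 := sub_ne_zero.2 hne.symm
  have h1 : (μ - z) • (T E A z * T E A μ) + T E A μ = T E A z := by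
    rw [← T_sub_T hz hμ]; abel
  have h2 : (μ - z) • (T E A μ * T E A z) + T E A μ = T E A z := by
    rw [← neg_sub z μ, neg_smul, ← T_sub_T hμ hz]; abel
  have hτ : tau μ z = (μ - z)⁻¹ := one_div _
  have h3 : (tau μ z • (1 : X →L[ℂ] X) - T E A μ) * ((μ - z) • 1 + (μ - z) ^ 2 • T E A z) = 1 := by
    have : (tau μ z • (1 : X →L[ℂ] X) - T E A μ) * ((μ - z) • 1 + (μ - z) ^ 2 • T E A z) =
        (tau μ z * (μ - z)) • (1 : X →L[ℂ] X) + (tau μ z * (μ - z)) • (μ - z) • T E A z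
          - (μ - z) • ((μ - z) • (T E A μ * T E A z) + T E A μ) := by
      simp only [sub_mul, mul_add, mul_smul_comm, smul_mul_assoc, one_mul, mul_one]
      module
    rw [this, hτ, inv_mul_cancel₀ h0, h2]
    module
  have h4 : ((μ - z) • 1 + (μ - z) ^ 2 • T E A z) * (tau μ z • (1 : X →L[ℂ] X) - T E A μ) = 1 := by
    have : ((μ - z) • 1 + (μ - z) ^ 2 • T E A z) * (tau μ z • (1 : X →L[ℂ] X) - T E A μ) =
        (tau μ z * (μ - z)) • (1 : X →L[ℂ] X) + (tau μ z * (μ - z)) • (μ - z) • T E A z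
          - (μ - z) • ((μ - z) • (T E A z * T E A μ) + T E A μ) := by
      simp only [mul_sub, add_mul, mul_smul_comm, smul_mul_assoc, one_mul, mul_one]
      module
    rw [this, hτ, inv_mul_cancel₀ h0, h1]
    module
  rw [T, mul_one]
  exact Ring.inverse_unit ⟨_, _, h3, h4⟩

theorem rieszProjection_T_tau (hC : ∀ i, IsRectifiableJordanCurve (C i))
    (hCρ : trace C ⊆ resolventSet E A) (hμ : μ ∈ resolventSet E A) (hμC : μ ∈ exteriorOf C) :
    rieszProjection (T E A μ) (fun i t => tau μ (C i t)) = pencilProjection E A C := by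
  have hT : ContinuousOn (T E A) (trace C) := (differentiableOn_T E A).continuousOn.mono hCρ
  have hi := continuousOn_inv_sub hμC.1
  -- This is `index C μ = 0`, times the identity operator; it absorbs the scalar term of
  -- `T_one_T_tau`.
  have h1 : contourIntegral C (fun z => (z - μ)⁻¹ • (1 : X →L[ℂ] X)) = 0 := by
    have h2 := contourIntegral_clm_comp hC hi
      (ContinuousLinearMap.toSpanSingleton ℂ (1 : X →L[ℂ] X))
    have h3 : contourIntegral C (fun z => (z - μ)⁻¹) = 0 := by
      simpa [index, Complex.I_ne_zero, Real.pi_ne_zero] using hμC.2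
    simpa [h3] using h2
  rw [rieszProjection_eq_pencilProjection, pencilProjection_eq, pencilProjection_eq,
    contourIntegral_tau hμC.1, ← sub_zero (contourIntegral C (T E A)), ← h1,
    ← contourIntegral_sub hC (g := fun z => (z - μ)⁻¹ • (1 : X →L[ℂ] X)) hT
      (hi.smul continuousOn_const)]
  congr 1
  refine contourIntegral_congr fun z hz => ?_
  have hne : z ≠ μ := ne_of_mem_of_not_mem hz hμC.1
  have h0 : μ - z ≠ 0 := sub_ne_zero.2 hne.symm
  have h5 : (z - μ)⁻¹ = -(μ - z)⁻¹ := by rw [← neg_sub, inv_neg]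
  have h6 : (μ - z)⁻¹ ^ 2 * (μ - z) = (μ - z)⁻¹ := by field_simp
  have h7 : (μ - z)⁻¹ ^ 2 * (μ - z) ^ 2 = 1 := by field_simp
  simp only [T_one_T_tau hμ (hCρ hz) hne, smul_add, smul_smul, h5, h6, h7, one_smul, neg_smul]
  abel

end Riesz

end OperatorPencil

theorem mainTheorem7 {X : Type*} [NormedAddCommGroup X] [NormedSpace ℂ X] [CompleteSpace X]
    (E A : X →L[ℂ] X) (σ : Set ℂ)
    (hσ : OperatorPencil.IsSpectralSet (OperatorPencil.pencilSpectrum E A) σ)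
    (hσb : Bornology.IsBounded σ) :
    -- `P_σ` depends only on `σ`
    (∀ (n m : ℕ) (U U' : Set ℂ) (C : Fin n → ℝ → ℂ) (C' : Fin m → ℝ → ℂ),
      OperatorPencil.Encloses (OperatorPencil.pencilSpectrum E A) σ U C →
      OperatorPencil.Encloses (OperatorPencil.pencilSpectrum E A) σ U' C' →
      OperatorPencil.pencilProjection E A C = OperatorPencil.pencilProjection E A C') ∧
    -- `P_σ` is a projection
    (∀ (n : ℕ) (U : Set ℂ) (C : Fin n → ℝ → ℂ),
      OperatorPencil.Encloses (OperatorPencil.pencilSpectrum E A) σ U C →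
      IsIdempotentElem (OperatorPencil.pencilProjection E A C)) ∧
    -- `P_σ` is the spectral projection of `T_μ` for `τ_μ(σ)`, along `τ_μ(C)`
    (∀ μ ∈ OperatorPencil.resolventSet E A,
      ∀ (n : ℕ) (U : Set ℂ) (C : Fin n → ℝ → ℂ),
      OperatorPencil.Encloses (OperatorPencil.pencilSpectrum E A) σ U C →
      μ ∈ OperatorPencil.exteriorOf C →
      (0 : ℂ) ∈ OperatorPencil.exteriorOf (fun i t => OperatorPencil.tau μ (C i t)) ∧
      OperatorPencil.IsPositivelyOrientedBoundary (OperatorPencil.tau μ '' U)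
        (fun i t => OperatorPencil.tau μ (C i t)) ∧
      OperatorPencil.IsSpectralSet (spectrum ℂ (OperatorPencil.T E A μ))
        (OperatorPencil.tau μ '' σ) ∧
      OperatorPencil.tau μ '' σ ⊆
        OperatorPencil.interiorOf (fun i t => OperatorPencil.tau μ (C i t)) ∧
      OperatorPencil.Encloses (spectrum ℂ (OperatorPencil.T E A μ)) (OperatorPencil.tau μ '' σ)
        (OperatorPencil.tau μ '' U) (fun i t => OperatorPencil.tau μ (C i t)) ∧
      OperatorPencil.pencilProjection E A C =
        OperatorPencil.rieszProjection (OperatorPencil.T E A μ)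
          (fun i t => OperatorPencil.tau μ (C i t)) ∧
      (∀ (m : ℕ) (V : Set ℂ) (D : Fin m → ℝ → ℂ),
        OperatorPencil.Encloses (spectrum ℂ (OperatorPencil.T E A μ))
          (OperatorPencil.tau μ '' σ) V D →
        OperatorPencil.pencilProjection E A C =
          OperatorPencil.rieszProjection (OperatorPencil.T E A μ) D)) := by
  refine ⟨fun n m U U' C C' h h' => OperatorPencil.pencilProjection_eq_of_encloses h h',
    fun n U C h => OperatorPencil.isIdempotentElem_pencilProjection h,
    fun μ hμ n U C h hμC => ?_⟩
  have hτ := h.tau hμC fun z hz => OperatorPencil.tau_mem_spectrum_T_iff hμ hz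
  have hR := OperatorPencil.rieszProjection_T_tau h.boundary.jordan
    h.trace_subset_resolventSet hμ hμC
  refine ⟨OperatorPencil.zero_mem_exteriorOf_tau hμC, hτ.boundary, hτ.isSpectralSet,
    hτ.subset_interiorOf, hτ, hR.symm, fun m V D hD => ?_⟩
  -- Both `τ_μ(C)` and `D` are admissible for the pencil `(1, T_μ)`, so independence of the contour
  -- compares them.
  rw [← OperatorPencil.pencilSpectrum_one] at hτ hD
  rw [← hR, OperatorPencil.rieszProjection_eq_pencilProjection,
    OperatorPencil.rieszProjection_eq_pencilProjection]
  exact OperatorPencil.pencilProjection_eq_of_encloses hτ hD
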